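/- Let $[n]=\{0,1,\dots,n-1\}$. For $n\ge 4$, the distinct $3$-dimensional De Bruijn graph on $n$ symbols has as vertices the triples $(a,b,c)$ of pairwise distinct elements of $[n]$, and as (directed) edges the pairs $\bigl((a,b,c),(b,c,d)\bigr)$ with $a,b,c,d\in[n]$ pairwise distinct. Let $p_{\mathrm{distinct}}(n)$ be the minimum, over all $2$-colorings of the vertices, of the fraction of edges that are monochromatic (both endpoints have the same color). For a measurable function $f\colon[0,1]^3\to\{0,1\}$ (a one-round randomized algorithm for $2$-coloring directed cycles) let $$p(f)=\Pr\bigl[f(A,B,C)=f(B,C,D)\bigr],$$ where $A,B,C,D$ are independent and uniformly distributed on $[0,1]$, and let $p^*=\inf_f p(f)$ over all such $f$. Then $$p^*\ \ge\ p_{\mathrm{distinct}}(10^6)\ \ge\ 0.23879 .$$ -/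

import Mathlib

open MeasureTheory

/-- Vertices of the distinct 3-dimensional De Bruijn graph on the symbols `0, …, n - 1`:
triples of pairwise distinct symbols. -/
abbrev DistinctVertex (n : ℕ) : Type :=
  {v : Fin n × Fin n × Fin n // v.1 ≠ v.2.1 ∧ v.1 ≠ v.2.2 ∧ v.2.1 ≠ v.2.2}

/-- Directed edges of the distinct 3-dimensional De Bruijn graph: the pairs
`((a, b, c), (b, c, d))` with `a, b, c, d` pairwise distinct symbols. -/
def distinctEdges (n : ℕ) : Set (DistinctVertex n × DistinctVertex n) :=
  {e | ∃ a b c d : Fin n, a ≠ b ∧ a ≠ c ∧ a ≠ d ∧ b ≠ c ∧ b ≠ d ∧ c ≠ d ∧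
    e.1.val = (a, b, c) ∧ e.2.val = (b, c, d)}

/-- The fraction of edges of the distinct De Bruijn graph that are monochromatic under the
2-coloring `h` of its vertices. (Meaningful when there is an edge, that is, for `4 ≤ n`.) -/
noncomputable def monochromaticFraction (n : ℕ) (h : DistinctVertex n → Bool) : ℝ :=
  ({e ∈ distinctEdges n | h e.1 = h e.2}.ncard : ℝ) / ((distinctEdges n).ncard : ℝ)

/-- The smallest fraction of monochromatic edges in a 2-coloring of the distinct
De Bruijn graph. -/
noncomputable def pDistinct (n : ℕ) : ℝ :=
  ⨅ h : DistinctVertex n → Bool, monochromaticFraction n h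

/-- `pDistinct n` is a minimum, not just an infimum: there are finitely many colorings. -/
theorem isLeast_pDistinct (n : ℕ) :
    IsLeast (Set.range (monochromaticFraction n)) (pDistinct n) :=
  ⟨exists_eq_ciInf_of_finite, by
    rintro _ ⟨h, rfl⟩
    exact ciInf_le (Set.finite_range _).bddBelow h⟩

/-- For a one-round algorithm `f : [0,1]³ → {0,1}`, the probability that
`f (A, B, C) = f (B, C, D)` for independent `A, B, C, D` uniformly distributed on `[0,1]`.
The measure is the product of four copies of the uniform measure on `[0,1]`. -/
noncomputable def monochromaticProb (f : unitInterval × unitInterval × unitInterval → Bool) : ℝ :=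
  (volume : Measure (Fin 4 → unitInterval)).real
    {x | f (x 0, x 1, x 2) = f (x 1, x 2, x 3)}

/-- The infimum of the monochromatic-edge probability over all one-round algorithms, that is,
over all measurable `f : [0,1]³ → {0,1}`. -/
noncomputable def pStar : ℝ :=
  ⨅ f : {f : unitInterval × unitInterval × unitInterval → Bool // Measurable f},
    monochromaticProb f.val

/-!
Write `g = ±1` for a coloring of the triples of pairwise distinct symbols; the monochromatic fraction
is `1/2 + E[g(a,b,c) g(b,c,d)] / 2`, the mean being over all quadruples of pairwise distinct symbols.

**Lower bound.** The six products of two of the four signs `g(a,b,c)`, `g(a,b,d)`, `g(a,c,d)`,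
`g(b,c,d)` are exactly, up to relabeling the symbols, the products that occur when the square of
`∑ t, (g(t,x,y) + g(x,y,t) + (√2 - 1) g(x,t,y))` is expanded and summed over `x, y`
(`sum_distinctQuads_linkSum`). Being squares, these sums are nonnegative, up to the diagonal terms,
which are smaller by a factor of order `n` (`neg_le_sum_linkSum_mul_linkSum`). Subtracting the
expansion from a multiple of `g(a,b,c) g(b,c,d)` leaves a quadratic form in the four signs, whose
minimum over the sixteen sign patterns is `-2` (`sign_form_nonneg`). Averaging gives
`(1 + 2√2) E[g(a,b,c) g(b,c,d)] ≥ -2 - (1 + √2)² / (n - 3)`, so the monochromatic fraction is at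
least `1/2 - 1/(1 + 2√2) - O(1/n)`, where `1/2 - 1/(1 + 2√2) = 0.238796…`. The weight `√2 - 1` and
the multiple `1 + 2√2` are chosen so that several sign patterns attain the minimum simultaneously.

**Comparison.** A one-round algorithm `f` and a point `x ∈ [0,1]ⁿ` give the coloring
`(a, b, c) ↦ f (x a, x b, x c)` of the De Bruijn graph. For a uniformly random `x` every edge is
monochromatic with probability `p(f)`, because any four distinct coordinates of `x` are independent
and uniform (`measurePreserving_comp_of_injective`). Hence the expected monochromatic fraction is
`p(f)`, and it is at least the minimum over all colorings.
-/

/-! ### Signs of a coloring of triples -/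

/-- The coloring `c` with values `±1` on triples of pairwise distinct elements, extended by `0` to
all other triples. -/
def colorSign {α : Type*} [DecidableEq α] (c : α → α → α → Bool) (x y z : α) : ℝ :=
  if x ≠ y ∧ x ≠ z ∧ y ≠ z then (if c x y z then 1 else -1) else 0

/-- The weighted sum of the signs of the triples in which `t` is inserted before, after and
between `x, y`. -/
noncomputable def linkSum {α : Type*} (g : α → α → α → ℝ) (x y t : α) : ℝ :=
  g t x y + g x y t + (√2 - 1) * g x t y

theorem colorSign_eq_one_or {α : Type*} [DecidableEq α] (c : α → α → α → Bool) {x y z : α}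
    (h : x ≠ y ∧ x ≠ z ∧ y ≠ z) : colorSign c x y z = 1 ∨ colorSign c x y z = -1 := by
  rw [colorSign, if_pos h]
  split_ifs <;> simp

theorem one_lt_sqrt_two : 1 < √(2 : ℝ) := by
  rw [Real.lt_sqrt] <;> norm_num

theorem sqrt_two_lt : √(2 : ℝ) < 3 / 2 := by
  rw [Real.sqrt_lt'] <;> norm_num

/-- The form vanishes on several sign patterns, among them the constant one, so its constant term
cannot be improved. -/
theorem sign_form_nonneg {g₁ g₂ g₃ g₄ : ℝ} (h₁ : g₁ = 1 ∨ g₁ = -1) (h₂ : g₂ = 1 ∨ g₂ = -1)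
    (h₃ : g₃ = 1 ∨ g₃ = -1) (h₄ : g₄ = 1 ∨ g₄ = -1) :
    0 ≤ (1 + 2 * √2) * (g₁ * g₄) + 2 -
      (2 * (g₁ * g₄) + g₁ * g₂ + g₃ * g₄ + (√2 - 1) ^ 2 * (g₂ * g₃) +
        2 * (√2 - 1) * (g₂ * g₄) + 2 * (√2 - 1) * (g₁ * g₃)) := by
  have hs : √(2 : ℝ) ^ 2 = 2 := Real.sq_sqrt (by norm_num)
  have h1 := one_lt_sqrt_two
  have h2 := sqrt_two_lt
  rcases h₁ with rfl | rfl <;> rcases h₂ with rfl | rfl <;> rcases h₃ with rfl | rfl <;>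
    rcases h₄ with rfl | rfl <;> linarith

theorem abs_colorSign_le {α : Type*} [DecidableEq α] (c : α → α → α → Bool) (x y z : α) :
    |colorSign c x y z| ≤ 1 := by
  unfold colorSign
  split_ifs <;> simp

theorem linkSum_sq_le {α : Type*} [DecidableEq α] (c : α → α → α → Bool) (x y t : α) :
    linkSum (colorSign c) x y t ^ 2 ≤ (1 + √2) ^ 2 := by
  have h1 := one_lt_sqrt_two
  obtain ⟨l₁, u₁⟩ := abs_le.1 (abs_colorSign_le c t x y)
  obtain ⟨l₂, u₂⟩ := abs_le.1 (abs_colorSign_le c x y t)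
  obtain ⟨l₃, u₃⟩ := abs_le.1 (abs_colorSign_le c x t y)
  refine sq_le_sq' ?_ ?_ <;> unfold linkSum <;> nlinarith

theorem linkSum_colorSign_eq_zero {α : Type*} [DecidableEq α] (c : α → α → α → Bool)
    {x y t : α} (h : ¬(x ≠ y ∧ x ≠ t ∧ y ≠ t)) : linkSum (colorSign c) x y t = 0 := by
  have h₁ : colorSign c t x y = 0 := if_neg fun h' => h ⟨h'.2.2, h'.1.symm, h'.2.1.symm⟩
  have h₂ : colorSign c x y t = 0 := if_neg h
  have h₃ : colorSign c x t y = 0 := if_neg fun h' => h ⟨h'.2.1, h'.1, h'.2.2.symm⟩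
  simp [linkSum, h₁, h₂, h₃]

/-! ### Sums over quadruples of distinct elements -/

section DistinctQuads

variable {α : Type*} [Fintype α] [DecidableEq α]

/-- The quadruples of pairwise distinct elements; they index the edges of the distinct De Bruijn
graph. -/
def distinctQuads (α : Type*) [Fintype α] [DecidableEq α] : Finset (α × α × α × α) :=
  {q | q.1 ≠ q.2.1 ∧ q.1 ≠ q.2.2.1 ∧ q.1 ≠ q.2.2.2 ∧ q.2.1 ≠ q.2.2.1 ∧ q.2.1 ≠ q.2.2.2 ∧
    q.2.2.1 ≠ q.2.2.2}

theorem mem_distinctQuads {a b c d : α} : (a, b, c, d) ∈ distinctQuads α ↔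
    a ≠ b ∧ a ≠ c ∧ a ≠ d ∧ b ≠ c ∧ b ≠ d ∧ c ≠ d := by
  simp [distinctQuads]

/-- Each of the nine products in the expansion is brought to the form `g(·,·,·) g(·,·,·)` with both
triples increasing in `(a, b, c, d)` by a permutation of the four symbols. -/
theorem sum_distinctQuads_linkSum (g : α → α → α → ℝ) :
    ∑ q ∈ distinctQuads α, linkSum g q.1 q.2.1 q.2.2.1 * linkSum g q.1 q.2.1 q.2.2.2 =
    ∑ q ∈ distinctQuads α, (2 * (g q.1 q.2.1 q.2.2.1 * g q.2.1 q.2.2.1 q.2.2.2) +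
      g q.1 q.2.1 q.2.2.1 * g q.1 q.2.1 q.2.2.2 + g q.1 q.2.2.1 q.2.2.2 * g q.2.1 q.2.2.1 q.2.2.2 +
      (√2 - 1) ^ 2 * (g q.1 q.2.1 q.2.2.2 * g q.1 q.2.2.1 q.2.2.2) +
      2 * (√2 - 1) * (g q.1 q.2.1 q.2.2.2 * g q.2.1 q.2.2.1 q.2.2.2) +
      2 * (√2 - 1) * (g q.1 q.2.1 q.2.2.1 * g q.1 q.2.2.1 q.2.2.2)) := by
  -- In the sums below, `q = (x, y, t, t')`.
  have hPP : ∑ q ∈ distinctQuads α, g q.2.2.1 q.1 q.2.1 * g q.2.2.2 q.1 q.2.1 =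
      ∑ q ∈ distinctQuads α, g q.1 q.2.2.1 q.2.2.2 * g q.2.1 q.2.2.1 q.2.2.2 :=
    Finset.sum_nbij' (fun q => (q.2.2.1, q.2.2.2, q.1, q.2.1))
      (fun q => (q.2.2.1, q.2.2.2, q.1, q.2.1))
      (by simp only [Prod.forall, mem_distinctQuads]; tauto)
      (by simp only [Prod.forall, mem_distinctQuads]; tauto) (by simp) (by simp) (by simp)
  have hRR : ∑ q ∈ distinctQuads α, g q.1 q.2.2.1 q.2.1 * g q.1 q.2.2.2 q.2.1 =
      ∑ q ∈ distinctQuads α, g q.1 q.2.1 q.2.2.2 * g q.1 q.2.2.1 q.2.2.2 :=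
    Finset.sum_nbij' (fun q => (q.1, q.2.2.1, q.2.2.2, q.2.1))
      (fun q => (q.1, q.2.2.2, q.2.1, q.2.2.1))
      (by simp only [Prod.forall, mem_distinctQuads]; tauto)
      (by simp only [Prod.forall, mem_distinctQuads]; tauto) (by simp) (by simp) (by simp)
  have hPQ : ∑ q ∈ distinctQuads α, g q.2.2.1 q.1 q.2.1 * g q.1 q.2.1 q.2.2.2 =
      ∑ q ∈ distinctQuads α, g q.1 q.2.1 q.2.2.1 * g q.2.1 q.2.2.1 q.2.2.2 :=
    Finset.sum_nbij' (fun q => (q.2.2.1, q.1, q.2.1, q.2.2.2))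
      (fun q => (q.2.1, q.2.2.1, q.1, q.2.2.2))
      (by simp only [Prod.forall, mem_distinctQuads]; tauto)
      (by simp only [Prod.forall, mem_distinctQuads]; tauto) (by simp) (by simp) (by simp)
  have hPR : ∑ q ∈ distinctQuads α, g q.2.2.1 q.1 q.2.1 * g q.1 q.2.2.2 q.2.1 =
      ∑ q ∈ distinctQuads α, g q.1 q.2.1 q.2.2.2 * g q.2.1 q.2.2.1 q.2.2.2 :=
    Finset.sum_nbij' (fun q => (q.2.2.1, q.1, q.2.2.2, q.2.1))
      (fun q => (q.2.1, q.2.2.2, q.1, q.2.2.1))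
      (by simp only [Prod.forall, mem_distinctQuads]; tauto)
      (by simp only [Prod.forall, mem_distinctQuads]; tauto) (by simp) (by simp)
      (by simp [mul_comm])
  have hQR : ∑ q ∈ distinctQuads α, g q.1 q.2.1 q.2.2.1 * g q.1 q.2.2.2 q.2.1 =
      ∑ q ∈ distinctQuads α, g q.1 q.2.1 q.2.2.1 * g q.1 q.2.2.1 q.2.2.2 :=
    Finset.sum_nbij' (fun q => (q.1, q.2.2.2, q.2.1, q.2.2.1))
      (fun q => (q.1, q.2.2.1, q.2.2.2, q.2.1))
      (by simp only [Prod.forall, mem_distinctQuads]; tauto)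
      (by simp only [Prod.forall, mem_distinctQuads]; tauto) (by simp) (by simp)
      (by simp [mul_comm])
  have hswap (F : α → α → α → α → ℝ) : ∑ q ∈ distinctQuads α, F q.1 q.2.1 q.2.2.2 q.2.2.1 =
      ∑ q ∈ distinctQuads α, F q.1 q.2.1 q.2.2.1 q.2.2.2 :=
    Finset.sum_nbij' (fun q => (q.1, q.2.1, q.2.2.2, q.2.2.1))
      (fun q => (q.1, q.2.1, q.2.2.2, q.2.2.1))
      (by simp only [Prod.forall, mem_distinctQuads]; tauto)
      (by simp only [Prod.forall, mem_distinctQuads]; tauto) (by simp) (by simp) (by simp)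
  have hQP := hswap fun x y t t' => g t x y * g x y t'
  have hRP := hswap fun x y t t' => g t x y * g x t' y
  have hRQ := hswap fun x y t t' => g x y t * g x t' y
  simp only [Finset.sum_add_distrib, ← Finset.mul_sum]
  rw [← hPP, ← hRR, ← hPR, ← hQR, ← hPQ]
  trans ∑ q ∈ distinctQuads α, (g q.2.2.1 q.1 q.2.1 * g q.1 q.2.1 q.2.2.2 +
      g q.2.2.2 q.1 q.2.1 * g q.1 q.2.1 q.2.2.1 + g q.1 q.2.1 q.2.2.1 * g q.1 q.2.1 q.2.2.2 +
      g q.2.2.1 q.1 q.2.1 * g q.2.2.2 q.1 q.2.1 +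
      (√2 - 1) ^ 2 * (g q.1 q.2.2.1 q.2.1 * g q.1 q.2.2.2 q.2.1) +
      (√2 - 1) * (g q.2.2.1 q.1 q.2.1 * g q.1 q.2.2.2 q.2.1) +
      (√2 - 1) * (g q.2.2.2 q.1 q.2.1 * g q.1 q.2.2.1 q.2.1) +
      (√2 - 1) * (g q.1 q.2.1 q.2.2.1 * g q.1 q.2.2.2 q.2.1) +
      (√2 - 1) * (g q.1 q.2.1 q.2.2.2 * g q.1 q.2.2.1 q.2.1))
  · refine Finset.sum_congr rfl fun q _ => ?_
    unfold linkSum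
    ring
  simp only [Finset.sum_add_distrib, ← Finset.mul_sum]
  rw [hQP, hRP, hRQ]
  ring

theorem sum_distinctQuads_eq (F : α → α → α → α → ℝ) :
    ∑ q ∈ distinctQuads α, F q.1 q.2.1 q.2.2.1 q.2.2.2 =
      ∑ x, ∑ y, ∑ t, ∑ t', if (x, y, t, t') ∈ distinctQuads α then F x y t t' else 0 := by
  simp only [← Fintype.sum_prod_type']
  rw [← Finset.sum_filter]
  exact Finset.sum_congr (by ext; simp) fun _ _ => rfl

/-- The square of the sum over `t` is nonnegative; its diagonal terms, one for every `n - 3`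
quadruples, are at most `(1 + √2)²`. -/
theorem neg_le_sum_linkSum_mul_linkSum (c : α → α → α → Bool) (hα : 3 ≤ Fintype.card α) :
    -((1 + √2) ^ 2 * ((distinctQuads α).card : ℝ)) ≤ ((Fintype.card α : ℝ) - 3) *
      ∑ q ∈ distinctQuads α, linkSum (colorSign c) q.1 q.2.1 q.2.2.1 *
        linkSum (colorSign c) q.1 q.2.1 q.2.2.2 := by
  set k := linkSum (colorSign c) with hk
  have hk0 {x y t : α} (h : ¬(x ≠ y ∧ x ≠ t ∧ y ≠ t)) : k x y t = 0 :=
    linkSum_colorSign_eq_zero c h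
  have hoff : -∑ x, ∑ y, ∑ t, k x y t ^ 2 ≤
      ∑ q ∈ distinctQuads α, k q.1 q.2.1 q.2.2.1 * k q.1 q.2.1 q.2.2.2 := by
    rw [sum_distinctQuads_eq fun x y t t' => k x y t * k x y t']
    simp only [← Finset.sum_neg_distrib]
    refine Finset.sum_le_sum fun x _ => Finset.sum_le_sum fun y _ => ?_
    have hsplit (t t' : α) : (if (x, y, t, t') ∈ distinctQuads α then k x y t * k x y t' else 0) =
        k x y t * k x y t' - if t = t' then k x y t ^ 2 else 0 := by
      by_cases htt : t = t'
      · subst htt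
        simp [mem_distinctQuads, sq]
      · by_cases h : x ≠ y ∧ x ≠ t ∧ y ≠ t
        · by_cases h' : x ≠ y ∧ x ≠ t' ∧ y ≠ t'
          · rw [if_pos (mem_distinctQuads.2 ⟨h.1, h.2.1, h'.2.1, h.2.2, h'.2.2, htt⟩), if_neg htt,
              sub_zero]
          · simp [hk0 h', htt]
        · simp [hk0 h, htt]
    simp only [hsplit, Finset.sum_sub_distrib, ← Finset.mul_sum, ← Finset.sum_mul,
      Finset.sum_ite_eq, Finset.mem_univ, if_true, Finset.sum_neg_distrib]
    nlinarith [mul_self_nonneg (∑ t, k x y t)]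
  have hdiag : ((Fintype.card α : ℝ) - 3) * ∑ x, ∑ y, ∑ t, k x y t ^ 2 =
      ∑ q ∈ distinctQuads α, k q.1 q.2.1 q.2.2.1 ^ 2 := by
    rw [sum_distinctQuads_eq fun x y t _ => k x y t ^ 2]
    simp only [Finset.mul_sum]
    refine Finset.sum_congr rfl fun x _ => Finset.sum_congr rfl fun y _ =>
      Finset.sum_congr rfl fun t _ => ?_
    by_cases h : x ≠ y ∧ x ≠ t ∧ y ≠ t
    · rw [← Finset.sum_filter, Finset.sum_const, nsmul_eq_mul]
      congr 1
      have hset : ({t' | (x, y, t, t') ∈ distinctQuads α} : Finset α) = {x, y, t}ᶜ := by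
        ext t'
        simp only [mem_distinctQuads, Finset.mem_filter, Finset.mem_univ, true_and,
          Finset.mem_compl, Finset.mem_insert, Finset.mem_singleton]
        grind
      rw [hset, Finset.card_compl, Finset.card_eq_three.2 ⟨x, y, t, h.1, h.2.1, h.2.2, rfl⟩,
        Nat.cast_sub hα, Nat.cast_ofNat]
    · simp [hk0 h]
  have hle : ∑ q ∈ distinctQuads α, k q.1 q.2.1 q.2.2.1 ^ 2 ≤
      (1 + √2) ^ 2 * ((distinctQuads α).card : ℝ) := by
    rw [mul_comm, ← nsmul_eq_mul]
    exact Finset.sum_le_card_nsmul _ _ _ fun q _ => linkSum_sq_le c _ _ _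
  have hn : (0 : ℝ) ≤ (Fintype.card α : ℝ) - 3 := sub_nonneg.2 (by exact_mod_cast hα)
  nlinarith [mul_le_mul_of_nonneg_left hoff hn]

theorem colorSign_correlation_bound (c : α → α → α → Bool) (hα : 4 ≤ Fintype.card α) :
    -(2 + (1 + √2) ^ 2 / ((Fintype.card α : ℝ) - 3)) * ((distinctQuads α).card : ℝ) ≤
      (1 + 2 * √2) * ∑ q ∈ distinctQuads α,
        colorSign c q.1 q.2.1 q.2.2.1 * colorSign c q.2.1 q.2.2.1 q.2.2.2 := by
  have hn : (0 : ℝ) < (Fintype.card α : ℝ) - 3 :=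
    sub_pos.2 (by exact_mod_cast (show 3 < Fintype.card α by lia))
  have hform : 0 ≤ ∑ q ∈ distinctQuads α,
      ((1 + 2 * √2) * (colorSign c q.1 q.2.1 q.2.2.1 * colorSign c q.2.1 q.2.2.1 q.2.2.2) + 2 -
        _) :=
    Finset.sum_nonneg fun q hq => by
      obtain ⟨hab, hac, had, hbc, hbd, hcd⟩ := mem_distinctQuads.1 hq
      exact sign_form_nonneg (colorSign_eq_one_or c ⟨hab, hac, hbc⟩)
        (colorSign_eq_one_or c ⟨hab, had, hbd⟩) (colorSign_eq_one_or c ⟨hac, had, hcd⟩)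
        (colorSign_eq_one_or c ⟨hbc, hbd, hcd⟩)
  rw [Finset.sum_sub_distrib, Finset.sum_add_distrib, ← Finset.mul_sum,
    ← sum_distinctQuads_linkSum (colorSign c), Finset.sum_const, nsmul_eq_mul] at hform
  have hlink := neg_le_sum_linkSum_mul_linkSum c (by lia)
  rw [← div_le_iff₀' hn, neg_div, mul_div_right_comm] at hlink
  linarith

end DistinctQuads

/-! ### The distinct De Bruijn graph -/

theorem monochromaticFraction_eq (n : ℕ) (c : Fin n → Fin n → Fin n → Bool) :
    monochromaticFraction n (fun v => c v.1.1 v.1.2.1 v.1.2.2) =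
      ((distinctQuads (Fin n)).filter
        fun q => c q.1 q.2.1 q.2.2.1 = c q.2.1 q.2.2.1 q.2.2.2).card /
          (distinctQuads (Fin n)).card := by
  -- An edge `((a, b, c), (b, c, d))` is encoded by the quadruple `(a, b, c, d)`.
  have hcount (p : Fin n × Fin n × Fin n × Fin n → Prop) [DecidablePred p] :
      {e ∈ distinctEdges n | p (e.1.1.1, e.1.1.2.1, e.1.1.2.2, e.2.1.2.2)}.ncard =
        ((distinctQuads (Fin n)).filter p).card := by
    rw [← Set.ncard_coe_finset]
    refine Set.ncard_congr (fun e _ => (e.1.1.1, e.1.1.2.1, e.1.1.2.2, e.2.1.2.2)) ?_ ?_ ?_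
    · rintro ⟨⟨v, hv⟩, ⟨w, hw⟩⟩ ⟨⟨a, b, c, d, hab, hac, had, hbc, hbd, hcd, rfl, rfl⟩, hp⟩
      simpa [mem_distinctQuads] using ⟨⟨hab, hac, had, hbc, hbd, hcd⟩, hp⟩
    · rintro ⟨⟨v, hv⟩, ⟨w, hw⟩⟩ ⟨⟨v', hv'⟩, ⟨w', hw'⟩⟩
        ⟨⟨a, b, c, d, -, -, -, -, -, -, rfl, rfl⟩, -⟩
        ⟨⟨a', b', c', d', -, -, -, -, -, -, rfl, rfl⟩, -⟩ h
      simp_all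
    · rintro ⟨a, b, c, d⟩ h
      obtain ⟨hq, hp⟩ := Finset.mem_filter.1 h
      obtain ⟨hab, hac, had, hbc, hbd, hcd⟩ := mem_distinctQuads.1 hq
      exact ⟨(⟨(a, b, c), hab, hac, hbc⟩, ⟨(b, c, d), hbc, hbd, hcd⟩),
        ⟨⟨a, b, c, d, hab, hac, had, hbc, hbd, hcd, rfl, rfl⟩, hp⟩, rfl⟩
  unfold monochromaticFraction
  congr 2
  · rw [← hcount]
    congr 1
    ext ⟨v, w⟩
    refine and_congr_right fun h => ?_
    obtain ⟨a, b, c, d, -, -, -, -, -, -, hv, hw⟩ := h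
    simp only at hv hw
    simp [hv, hw]
  · simpa using hcount fun _ => True

theorem card_distinctQuads_pos {n : ℕ} (hn : 4 ≤ n) : 0 < (distinctQuads (Fin n)).card :=
  Finset.card_pos.2 ⟨(⟨0, by lia⟩, ⟨1, by lia⟩, ⟨2, by lia⟩, ⟨3, by lia⟩), by
    simp [mem_distinctQuads]⟩

theorem le_monochromaticFraction {n : ℕ} (hn : 4 ≤ n) (h : DistinctVertex n → Bool) :
    1 / 2 - (2 + (1 + √2) ^ 2 / ((n : ℝ) - 3)) / (2 * (1 + 2 * √2)) ≤
      monochromaticFraction n h := by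
  set c : Fin n → Fin n → Fin n → Bool := fun x y z =>
    if hd : x ≠ y ∧ x ≠ z ∧ y ≠ z then h ⟨(x, y, z), hd⟩ else false with hc
  have hhc : h = fun v => c v.1.1 v.1.2.1 v.1.2.2 := by
    ext v
    simp only [hc]
    rw [dif_pos v.2]
  rw [hhc, monochromaticFraction_eq]
  have hcard : (0 : ℝ) < (distinctQuads (Fin n)).card := by exact_mod_cast card_distinctQuads_pos hn
  have hsum : ((((distinctQuads (Fin n)).filter
      fun q => c q.1 q.2.1 q.2.2.1 = c q.2.1 q.2.2.1 q.2.2.2).card : ℕ) : ℝ) =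
      ∑ q ∈ distinctQuads (Fin n), (1 / 2 + 1 / 2 *
        (colorSign c q.1 q.2.1 q.2.2.1 * colorSign c q.2.1 q.2.2.1 q.2.2.2)) := by
    rw [Finset.card_filter, Nat.cast_sum]
    refine Finset.sum_congr rfl fun q hq => ?_
    obtain ⟨hab, hac, had, hbc, hbd, hcd⟩ := mem_distinctQuads.1 hq
    have h₁ : colorSign c q.1 q.2.1 q.2.2.1 = if c q.1 q.2.1 q.2.2.1 then 1 else -1 :=
      if_pos ⟨hab, hac, hbc⟩
    have h₄ : colorSign c q.2.1 q.2.2.1 q.2.2.2 = if c q.2.1 q.2.2.1 q.2.2.2 then 1 else -1 :=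
      if_pos ⟨hbc, hbd, hcd⟩
    rw [h₁, h₄]
    cases c q.1 q.2.1 q.2.2.1 <;> cases c q.2.1 q.2.2.1 q.2.2.2 <;> norm_num
  rw [hsum, Finset.sum_add_distrib, ← Finset.mul_sum, Finset.sum_const, nsmul_eq_mul,
    le_div_iff₀ hcard]
  have hbound := colorSign_correlation_bound c (by simpa using hn)
  rw [Fintype.card_fin, ← div_le_iff₀' (by positivity)] at hbound
  generalize ((distinctQuads (Fin n)).card : ℝ) = N at *
  generalize 2 + (1 + √2) ^ 2 / ((n : ℝ) - 3) = K at *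
  have hK : K / (2 * (1 + 2 * √2)) * N = -(-K * N / (1 + 2 * √2)) / 2 := by
    field_simp
  linarith

theorem pDistinct_ge : (0.23879 : ℝ) ≤ pDistinct (10 ^ 6) := by
  refine le_ciInf fun h => le_trans ?_ (le_monochromaticFraction (by norm_num) h)
  have hlo : (1.414213 : ℝ) ≤ √2 := Real.le_sqrt_of_sq_le (by norm_num)
  have hs : √(2 : ℝ) ^ 2 = 2 := Real.sq_sqrt (by norm_num)
  have hup := sqrt_two_lt
  push_cast
  rw [le_sub_comm, div_le_iff₀ (by positivity), ← le_sub_iff_add_le', div_le_iff₀ (by norm_num)]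
  nlinarith

/-! ### One-round algorithms as random colorings -/

theorem measurePreserving_comp_of_injective {ι κ Ω : Type*} [Fintype ι] [Fintype κ]
    [MeasureSpace Ω] [IsProbabilityMeasure (volume : Measure Ω)] {e : κ → ι}
    (he : Function.Injective e) :
    MeasurePreserving (fun x : ι → Ω => x ∘ e) volume volume := by
  classical
  refine ⟨by fun_prop, (Measure.pi_eq fun s hs => ?_).symm⟩
  rw [Measure.map_apply (by fun_prop) (.univ_pi hs)]
  -- The coordinates outside the range of `e` are unconstrained.
  have hpre : (fun x : ι → Ω => x ∘ e) ⁻¹' Set.univ.pi s =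
      Set.univ.pi (Function.extend e s fun _ => Set.univ) := by
    ext x
    simp only [Set.mem_preimage, Set.mem_univ_pi, Function.comp_apply]
    refine ⟨fun h i => ?_, fun h j => by simpa [he.extend_apply] using h (e j)⟩
    by_cases hi : ∃ j, e j = i
    · obtain ⟨j, rfl⟩ := hi
      simpa [he.extend_apply] using h j
    · simp [Function.extend_apply' _ _ _ hi]
  rw [hpre, volume_pi_pi]
  rw [← Finset.prod_subset (Finset.subset_univ (Finset.univ.image e)), Finset.prod_image he.injOn]
  · simp [he.extend_apply]
  · intro i _ hi
    rw [Function.extend_apply' _ _ _ (by simpa using hi), measure_univ]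

theorem pDistinct_le_monochromaticProb {n : ℕ} (hn : 4 ≤ n)
    {f : unitInterval × unitInterval × unitInterval → Bool} (hf : Measurable f) :
    pDistinct n ≤ monochromaticProb f := by
  set A : Fin n × Fin n × Fin n × Fin n → Set (Fin n → unitInterval) := fun q =>
    {x | f (x q.1, x q.2.1, x q.2.2.1) = f (x q.2.1, x q.2.2.1, x q.2.2.2)} with hA
  have hAm (q) : MeasurableSet (A q) := measurableSet_eq_fun (by fun_prop) (by fun_prop)
  have hprob {q} (hq : q ∈ distinctQuads (Fin n)) : volume.real (A q) = monochromaticProb f := by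
    obtain ⟨a, b, c, d⟩ := q
    have he : Function.Injective ![a, b, c, d] := by
      obtain ⟨hab, hac, had, hbc, hbd, hcd⟩ := mem_distinctQuads.1 hq
      intro i j hij
      fin_cases i <;> fin_cases j <;> simp_all
    have hm : MeasurableSet {y : Fin 4 → unitInterval | f (y 0, y 1, y 2) = f (y 1, y 2, y 3)} :=
      measurableSet_eq_fun (by fun_prop) (by fun_prop)
    exact (measurePreserving_comp_of_injective he).measureReal_preimage hm.nullMeasurableSet
  have hcard : (0 : ℝ) < (distinctQuads (Fin n)).card := by exact_mod_cast card_distinctQuads_pos hn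
  have hpoint (x : Fin n → unitInterval) : pDistinct n * (distinctQuads (Fin n)).card ≤
      ∑ q ∈ distinctQuads (Fin n), (A q).indicator 1 x := by
    have h := (isLeast_pDistinct n).2 (Set.mem_range_self fun v => f (x v.1.1, x v.1.2.1, x v.1.2.2))
    rw [monochromaticFraction_eq n fun a b c => f (x a, x b, x c), le_div_iff₀ hcard,
      Finset.card_filter] at h
    simpa [Set.indicator_apply, hA] using h
  have hint (q) : Integrable ((A q).indicator (1 : (Fin n → unitInterval) → ℝ)) :=
    (integrable_const (1 : ℝ)).indicator (hAm q)
  have hmean := integral_mono (μ := volume) (integrable_const _)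
    (integrable_finsetSum _ fun q _ => hint q) hpoint
  rw [integral_finsetSum _ fun q _ => hint q,
    Finset.sum_congr rfl fun q hq => (integral_indicator_one (hAm q)).trans (hprob hq)] at hmean
  simpa [mul_comm, hcard] using hmean

theorem mainTheorem2 :
    (0.23879 : ℝ) ≤ pDistinct (10 ^ 6) ∧ pDistinct (10 ^ 6) ≤ pStar := by
  have : Nonempty {f : unitInterval × unitInterval × unitInterval → Bool // Measurable f} :=
    ⟨⟨fun _ => true, measurable_const⟩⟩
  exact ⟨pDistinct_ge, le_ciInf fun f => pDistinct_le_monochromaticProb (by norm_num) f.2⟩
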